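/- **Theorem (lifting of Stinespring representations).** For a complex Hilbert space $H$, let $\mathcal K(H)\subseteq\mathcal B(H)$ be the compact and the bounded operators on $H$. A linear map $\Phi:\mathcal K(H)\to\mathcal B(H)$ is *completely positive* if $\sum_{k,l=1}^n(\Phi(a_k^*a_l)\xi_l,\xi_k)\ge 0$ for all $n$, $a_1,\dots,a_n\in\mathcal K(H)$, $\xi_1,\dots,\xi_n\in H$, and it is a *$\mathcal D$-bimodule map*, for $\mathcal D\subseteq\mathcal B(H)$, if $\Phi(axb)=a\Phi(x)b$ for all $a,b\in\mathcal D$, $x\in\mathcal K(H)$. For an at most countable cardinal $\alpha$, let $H^\alpha$ be the Hilbert space direct sum of $\alpha$ copies of $H$, and $x\otimes 1_\alpha$ the operator on $H^\alpha$ that acts as $x\in\mathcal B(H)$ in each coordinate. For $\mathcal S\subseteq\mathcal B(H)$, let $M_{\alpha,1}(\mathcal S)$ be the set of bounded column operators $V=(a_i)_i:H\to H^\alpha$ with all entries $a_i\in\mathcal S$. Such a $V$ *implements a representation* of $\Phi$ if $\Phi(x)=V^*(x\otimes 1_\alpha)V$ for all $x\in\mathcal K(H)$, and the representation is *minimal*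 if the closed linear span of $\{(x\otimes 1_\alpha)V\xi:x\in\mathcal K(H),\ \xi\in H\}$ is $H^\alpha$. Commutants are denoted by $'$. Let $H_2$ be a separable complex Hilbert space, let $\mathcal D_2\subseteq\mathcal B(H_2)$ be a $C^*$-subalgebra containing the identity operator, and let $H_1\subseteq H_2$ be a non-zero closed subspace such that the projection $p$ of $H_2$ onto $H_1$ belongs to $\mathcal D_2$. Put $\mathcal D_1=p\mathcal D_2p$, regarded as acting on $H_1$, so that $\mathcal D_1'\subseteq\mathcal B(H_1)$. Let $\Phi:\mathcal K(H_2)\to\mathcal B(H_2)$ be a completely positive $\mathcal D_2$-bimodule map, and let $\Psi:\mathcal K(H_1)\to\mathcal B(H_1)$ be given by $\Psi(x)=\Phi(x)|_{H_1}$, where $\mathcal K(H_1)$ is regarded as a subset of $\mathcal K(H_2)$ by extending operators by $0$ on $H_1^\perp$. Let $\beta$ be an at most countable cardinal and suppose that $V\in M_{\beta,1}(\mathcal D_1')$ implements a minimal representation of $\Psi$. Then there exist an at most countable cardinal $\gamma\ge\beta$ and an operator $W\in M_{\gamma,1}(\mathcal D_2')$ which implements a minimal representation of $\Phi$, such that $W|_{H_1}=V$.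 In the last equality $H_1^\beta$ is identified with $H_1^\beta\oplus 0\subseteq H_1^\gamma\subseteq H_2^\gamma$ along some injection of the index set of $\beta$ into that of $\gamma$: for $\xi\in H_1$, the coordinates of $W\xi$ at the indices from $\beta$ are those of $V\xi$, and all its other coordinates are $0$. -/

import Mathlib

universe u v

namespace StinespringLift

section Basic

variable {H : Type u} [NormedAddCommGroup H] [InnerProductSpace ℂ H]

/-- The space `K(H)` of compact operators on `H`. -/
abbrev CompactOps (H : Type u) [NormedAddCommGroup H] [InnerProductSpace ℂ H] :
    Submodule ℂ (H →L[ℂ] H) :=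
  compactOperator (RingHom.id ℂ) H H

/-- The compact operator `a x b`, for bounded `a, b` and compact `x`. -/
def sandwich {G : Type v} [NormedAddCommGroup G] [InnerProductSpace ℂ G]
    (a : H →L[ℂ] G) (x : CompactOps H) (b : G →L[ℂ] H) : CompactOps G :=
  ⟨a ∘L (x : H →L[ℂ] H) ∘L b, (x.2.comp_clm b).clm_comp a⟩

/-- The compact operator `x* y`, for compact `x` and `y`. -/
noncomputable def adjMul [CompleteSpace H] (x y : CompactOps H) : CompactOps H :=
  ⟨(x : H →L[ℂ] H).adjoint ∘L (y : H →L[ℂ] H), y.2.clm_comp (x : H →L[ℂ] H).adjoint⟩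

open scoped ComplexOrder in
/-- Complete positivity of `Φ : K(H) → B(H)`: for all `a₁, …, aₙ` in `K(H)` and `ξ₁, …, ξₙ` in `H`,
`∑ₖₗ (Φ(aₖ* aₗ) ξₗ, ξₖ) ≥ 0`. Mathlib's inner product is conjugate linear in its first variable. -/
def IsCompletelyPositive [CompleteSpace H] (Φ : CompactOps H →ₗ[ℂ] (H →L[ℂ] H)) : Prop :=
  ∀ (n : ℕ) (a : Fin n → CompactOps H) (ξ : Fin n → H),
    0 ≤ ∑ k, ∑ l, inner ℂ (ξ k) (Φ (adjMul (a k) (a l)) (ξ l))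

/-- `Φ` is a `D`-bimodule map: `Φ(a x b) = a Φ(x) b` for `a, b ∈ D`. -/
def IsBimoduleMap (D : Set (H →L[ℂ] H)) (Φ : CompactOps H →ₗ[ℂ] (H →L[ℂ] H)) : Prop :=
  ∀ a ∈ D, ∀ b ∈ D, ∀ x : CompactOps H, Φ (sandwich a x b) = a ∘L Φ x ∘L b

/-- The direct sum `H^α` of copies of `H` indexed by `α`, as a Hilbert space. -/
abbrev Copies (α : Type v) (H : Type u) [NormedAddCommGroup H] : Type (max v u) :=
  lp (fun _ : α => H) 2

theorem memℓp_ampliation {α : Type v} (x : H →L[ℂ] H) (f : Copies α H) :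
    Memℓp (fun i => x (f i)) 2 := by
  have h : Memℓp ((‖x‖ : ℝ) • fun i => ‖f i‖) 2 := (lp.memℓp (lp.toNorm f)).const_smul ‖x‖
  exact h.mono fun i => by simpa using x.le_opNorm (f i)

/-- The ampliation `x ⊗ 1_α`, acting on `H^α` coordinatewise. -/
noncomputable def ampliation (α : Type v) (x : H →L[ℂ] H) : Copies α H →L[ℂ] Copies α H :=
  LinearMap.mkContinuous
    { toFun := fun f => ⟨fun i => x (f i), memℓp_ampliation x f⟩
      map_add' := fun f g => by ext i; exact map_add x (f i) (g i)
      map_smul' := fun c f => by ext i; simp }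
    ‖x‖ (fun f => by
      have hp : 0 < (2 : ENNReal).toReal := by norm_num
      refine lp.norm_le_of_forall_sum_le hp (by positivity) fun s => ?_
      calc ∑ i ∈ s, ‖x (f i)‖ ^ (2 : ENNReal).toReal
          ≤ ∑ i ∈ s, ‖x‖ ^ (2 : ENNReal).toReal * ‖f i‖ ^ (2 : ENNReal).toReal := by
            refine Finset.sum_le_sum fun i _ => ?_
            rw [← Real.mul_rpow (norm_nonneg _) (norm_nonneg _)]
            exact Real.rpow_le_rpow (norm_nonneg _) (x.le_opNorm _) hp.le
        _ ≤ (‖x‖ * ‖f‖) ^ (2 : ENNReal).toReal := by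
            rw [← Finset.mul_sum, Real.mul_rpow (norm_nonneg _) (norm_nonneg _)]
            exact mul_le_mul_of_nonneg_left (lp.sum_rpow_le_norm_rpow hp f s) (by positivity))

@[simp] theorem ampliation_apply (α : Type v) (x : H →L[ℂ] H) (f : Copies α H) (i : α) :
    ampliation α x f i = x (f i) := rfl

/-- The `i`-th entry `aᵢ ∈ B(H)` of a bounded column operator `V = (aᵢ)ᵢ : H → H^α`. -/
noncomputable def entry {α : Type v} (V : H →L[ℂ] Copies α H) (i : α) : H →L[ℂ] H :=
  lp.evalCLM ℂ (fun _ : α => H) 2 i ∘L V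

/-- `V ∈ M_{α,1}(S)`: the bounded column operator `V : H → H^α` has all its entries in `S`. -/
def HasEntriesIn {α : Type v} (V : H →L[ℂ] Copies α H) (S : Set (H →L[ℂ] H)) : Prop :=
  ∀ i, entry V i ∈ S

/-- `V` implements a representation of `Φ`: `Φ(x) = V* (x ⊗ 1_α) V` for all compact `x`. -/
def Implements [CompleteSpace H] {α : Type v} (V : H →L[ℂ] Copies α H)
    (Φ : CompactOps H →ₗ[ℂ] (H →L[ℂ] H)) : Prop :=
  ∀ x : CompactOps H, Φ x = V.adjoint ∘L ampliation α (x : H →L[ℂ] H) ∘L V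

/-- `V` implements a minimal representation of `Φ`: it implements a representation, and the closed
linear span of the vectors `(x ⊗ 1_α) V ξ`, with `x` compact and `ξ ∈ H`, is all of `H^α`. -/
def ImplementsMinimal [CompleteSpace H] {α : Type v} (V : H →L[ℂ] Copies α H)
    (Φ : CompactOps H →ₗ[ℂ] (H →L[ℂ] H)) : Prop :=
  Implements V Φ ∧
    (Submodule.span ℂ {η : Copies α H | ∃ (x : CompactOps H) (ξ : H),
      η = ampliation α (x : H →L[ℂ] H) (V ξ)}).topologicalClosure = ⊤

end Basic

section Subspace

variable {H₂ : Type u} [NormedAddCommGroup H₂] [InnerProductSpace ℂ H₂]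
variable (H₁ : Submodule ℂ H₂) [H₁.HasOrthogonalProjection]

/-- The set `p D p`, for `p` the projection onto `H₁`, regarded as a set of operators on `H₁`. -/
noncomputable def corner (D : Set (H₂ →L[ℂ] H₂)) : Set (H₁ →L[ℂ] H₁) :=
  {a | ∃ d ∈ D, a = H₁.orthogonalProjectionOnto ∘L d ∘L H₁.subtypeL}

/-- The canonical inclusion `K(H₁) ⊆ K(H₂)`, extending an operator by zero on the orthogonal
complement of `H₁`. -/
noncomputable def extendByZero (x : CompactOps H₁) : CompactOps H₂ :=
  sandwich H₁.subtypeL x H₁.orthogonalProjectionOnto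

/-- The compression `Ψ : K(H₁) → B(H₁)` of `Φ : K(H₂) → B(H₂)`. When `Φ` is a bimodule map over a
set containing the projection onto `H₁`, this is `Ψ(x) = Φ(x)|_{H₁}`; see `coe_compress_apply`. -/
noncomputable def compress (Φ : CompactOps H₂ →ₗ[ℂ] (H₂ →L[ℂ] H₂)) :
    CompactOps H₁ →ₗ[ℂ] (H₁ →L[ℂ] H₁) where
  toFun x := H₁.orthogonalProjectionOnto ∘L Φ (extendByZero H₁ x) ∘L H₁.subtypeL
  map_add' x y := by
    have h : extendByZero H₁ (x + y) = extendByZero H₁ x + extendByZero H₁ y := by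
      ext; simp [extendByZero, sandwich]
    rw [h, map_add]; ext; simp
  map_smul' c x := by
    have h : extendByZero H₁ (c • x) = c • extendByZero H₁ x := by
      ext; simp [extendByZero, sandwich]
    rw [h, map_smul]; ext; simp

theorem coe_compress_apply {D : Set (H₂ →L[ℂ] H₂)} (hp : H₁.starProjection ∈ D)
    {Φ : CompactOps H₂ →ₗ[ℂ] (H₂ →L[ℂ] H₂)} (hΦ : IsBimoduleMap D Φ)
    (x : CompactOps H₁) (ξ : H₁) :
    (compress H₁ Φ x ξ : H₂) = Φ (extendByZero H₁ x) ξ := by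
  have h : sandwich H₁.starProjection (extendByZero H₁ x) H₁.starProjection
      = extendByZero H₁ x := by
    ext z
    have hz : H₁.orthogonalProjectionOnto (H₁.starProjection z) = H₁.orthogonalProjectionOnto z := by
      rw [Submodule.starProjection_apply, Submodule.orthogonalProjectionOnto_mem_subspace_eq_self]
    simp [extendByZero, sandwich, hz]
  have h2 := hΦ _ hp _ hp (extendByZero H₁ x)
  rw [h] at h2
  have h3 : Φ (extendByZero H₁ x) (ξ : H₂)
      = H₁.starProjection (Φ (extendByZero H₁ x) (H₁.starProjection (ξ : H₂))) :=
    congrArg (fun T : H₂ →L[ℂ] H₂ => T (ξ : H₂)) h2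
  rw [h3]
  simp [compress]

variable {H₁}

/-- `W|_{H₁} = V`, where `V : H₁ → H₁^β`, `W : H₂ → H₂^γ`, and `H₁^β` is identified with
`H₁^β ⊕ 0 ⊆ H₁^γ ⊆ H₂^γ` along an injection `e` of the index sets. -/
def RestrictsTo {β γ : Type v} (e : β ↪ γ) (W : H₂ →L[ℂ] Copies γ H₂)
    (V : H₁ →L[ℂ] Copies β H₁) : Prop :=
  ∀ ξ : H₁, (∀ i : β, W (ξ : H₂) (e i) = (V ξ i : H₂)) ∧
    ∀ j : γ, j ∉ Set.range e → W (ξ : H₂) j = 0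

end Subspace

end StinespringLift

namespace StinespringLift

/-! The map Φ is determined by the numbers ⟨η, Φ(|u⟩⟨v|)ξ⟩, because it is bounded and the
finite-rank operators are dense in the compact ones. Complete positivity makes them a positive
semidefinite kernel, hence the Gram matrix of a total family `k v ξ`, conjugate linear in `v`, in a
Hilbert space `L` (`exists_kernel_vectors`). The minimal Stinespring space is H ⊗ L, so `L` records
the multiplicity. An orthonormal basis `b` of `L` cuts H ⊗ L into copies of H and gives a column `W`
with ⟨v, (Wξ)ᵢ⟩ = ⟨bᵢ, k v ξ⟩ (`exists_column`). Every such `W` implements a minimal representation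
(`implementsMinimal`), and the bimodule property makes its entries commute with the algebra.

Lifting `V` thus reduces to choosing a basis. For v, ξ in H₁ the families (⟨v, (Vξ)ᵢ⟩)ᵢ are total in
ℓ²(β) by minimality and have the Gram matrix of the `k v ξ`, so ℓ²(β) embeds isometrically in `L`
(`exists_linearIsometry`). Extend the image of its standard basis to an orthonormal basis of `L`: on
H₁ the old indices reproduce `V`, and the new ones give 0 by orthogonality (`restrictsTo_of_basis`).
-/

/-- A positive linear map between C⋆-algebras is bounded and preserves adjoints; positivity is only
tested on elements `y⋆ y`, so that the source need not carry an order. -/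
theorem exists_bound_and_map_star_of_nonneg {A B : Type*} [NonUnitalCStarAlgebra A]
    [NonUnitalCStarAlgebra B] [PartialOrder B] [StarOrderedRing B] (f : A →ₗ[ℂ] B)
    (hf : ∀ y, 0 ≤ f (star y * y)) :
    (∃ C : ℝ, 0 ≤ C ∧ ∀ x, ‖f x‖ ≤ C * ‖x‖) ∧ ∀ x, f (star x) = star (f x) := by
  let _ : PartialOrder A := CStarAlgebra.spectralOrder A
  have : StarOrderedRing A := CStarAlgebra.spectralOrderedRing A
  have hpos : ∀ x, 0 ≤ x → 0 ≤ f x := by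
    intro x hx
    obtain ⟨y, rfl⟩ := CStarAlgebra.nonneg_iff_eq_star_mul_self.1 hx
    exact hf y
  obtain ⟨C, hC⟩ := (PositiveLinearMap.mk₀ f hpos).exists_norm_apply_le
  refine ⟨⟨C, C.2, hC⟩, fun x => ?_⟩
  obtain ⟨y, hy, -, hxy⟩ := CStarAlgebra.exists_sum_four_nonneg x
  rw [hxy]
  simp only [star_sum, map_sum, star_smul, map_smul]
  refine Finset.sum_congr rfl fun i _ => ?_
  rw [(hy i).isSelfAdjoint.star_eq, (hpos _ (hy i)).isSelfAdjoint.star_eq]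

/-! ### Compact operators, and automatic boundedness of completely positive maps -/

section CompactOperators

variable {H : Type u} [NormedAddCommGroup H] [InnerProductSpace ℂ H]

/-- A compact operator is approximated in norm by its compressions to finite-dimensional
subspaces of the range space. -/
theorem exists_norm_sub_starProjection_comp_le {x : H →L[ℂ] H} (hx : IsCompactOperator x)
    {ε : ℝ} (hε : 0 < ε) :
    ∃ (M : Submodule ℂ H) (_ : FiniteDimensional ℂ M), ‖x - M.starProjection ∘L x‖ ≤ ε := by
  have htb : TotallyBounded (x '' Metric.closedBall 0 1) :=
    ((hx.isCompact_closure_image_closedBall (f := (x : H →ₗ[ℂ] H)) 1).totallyBounded).subset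
      subset_closure
  -- The span of a finite ε-net for the image of the unit ball serves as `M`; projecting onto it
  -- does at least as well as the nearest net point.
  obtain ⟨t, ht, hcov⟩ := Metric.totallyBounded_iff.1 htb ε hε
  have hfin : FiniteDimensional ℂ (Submodule.span ℂ t) := FiniteDimensional.span_of_finite ℂ ht
  refine ⟨Submodule.span ℂ t, hfin, ?_⟩
  refine ContinuousLinearMap.opNorm_le_of_unit_norm (𝕜 := ℂ) hε.le fun v hv => ?_
  obtain ⟨y, hy, hyv⟩ := Set.mem_iUnion₂.1 (hcov ⟨v, by simp [hv], rfl⟩)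
  rw [sub_apply, ContinuousLinearMap.comp_apply, Submodule.starProjection_minimal]
  refine (ciInf_le ⟨0, ?_⟩ (⟨y, Submodule.subset_span hy⟩ : Submodule.span ℂ t)).trans ?_
  · rintro _ ⟨_, rfl⟩
    positivity
  · rw [Metric.mem_ball, dist_eq_norm] at hyv
    exact hyv.le

theorem isCompactOperator_rankOne (u v : H) :
    IsCompactOperator (InnerProductSpace.rankOne ℂ u v : H →L[ℂ] H) := by
  have h : IsCompactOperator (id : ℂ → ℂ) := isCompactOperator_id
  exact (h.clm_comp (ContinuousLinearMap.toSpanSingleton ℂ u)).comp_clm (innerSL ℂ v)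

/-- The rank-one operator `|u⟩⟨v|` as a compact operator. -/
noncomputable def rankOneCompact (u v : H) : CompactOps H :=
  ⟨InnerProductSpace.rankOne ℂ u v, isCompactOperator_rankOne u v⟩

@[simp] theorem coe_rankOneCompact (u v : H) :
    (rankOneCompact u v : H →L[ℂ] H) = InnerProductSpace.rankOne ℂ u v := rfl

theorem starProjection_eq_sum_rankOne (M : Submodule ℂ H) [FiniteDimensional ℂ M] :
    M.starProjection = ∑ i, InnerProductSpace.rankOne ℂ
      (stdOrthonormalBasis ℂ M i : H) (stdOrthonormalBasis ℂ M i : H) :=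
  (stdOrthonormalBasis ℂ M).starProjection_eq_sum_rankOne

theorem isCompactOperator_starProjection (M : Submodule ℂ H) [FiniteDimensional ℂ M] :
    IsCompactOperator (M.starProjection : H →L[ℂ] H) := by
  change M.starProjection ∈ CompactOps H
  rw [starProjection_eq_sum_rankOne]
  exact Submodule.sum_mem _ fun i _ => isCompactOperator_rankOne _ _

variable [CompleteSpace H]

/-- Since P_M x approximates x in norm, x* P_M approximates x*; these are compact, and the compact
operators are norm closed. -/
theorem isCompactOperator_adjoint {x : H →L[ℂ] H} (hx : IsCompactOperator x) :
    IsCompactOperator x.adjoint := by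
  have hcl : IsClosed {f : H →L[ℂ] H | IsCompactOperator f} :=
    isClosed_setOfPred_isCompactOperator
  refine hcl.closure_subset_iff.2 subset_rfl (Metric.mem_closure_iff.2 fun ε hε => ?_)
  obtain ⟨M, hM, hle⟩ := exists_norm_sub_starProjection_comp_le hx (half_pos hε)
  refine ⟨x.adjoint ∘L M.starProjection,
    (isCompactOperator_starProjection M).clm_comp x.adjoint, ?_⟩
  have h : x.adjoint - x.adjoint ∘L M.starProjection
      = (x - M.starProjection ∘L x).adjoint := by
    rw [map_sub, ContinuousLinearMap.adjoint_comp,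
      (isSelfAdjoint_starProjection M).adjoint_eq]
  rw [dist_eq_norm, h, LinearIsometryEquiv.norm_map]
  linarith

variable (H) in
/-- The compact operators as a non-unital star subalgebra of the bounded operators. -/
def compactAlgebra : NonUnitalStarSubalgebra ℂ (H →L[ℂ] H) where
  carrier := {x | IsCompactOperator x}
  add_mem' hx hy := hx.add hy
  zero_mem' := isCompactOperator_zero
  mul_mem' {x _} _ hy := hy.clm_comp x
  smul_mem' c _ hx := hx.smul c
  star_mem' hx := isCompactOperator_adjoint hx

theorem isClosed_compactAlgebra : IsClosed (compactAlgebra H : Set (H →L[ℂ] H)) :=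
  isClosed_setOfPred_isCompactOperator

/-- The adjoint of a compact operator. -/
noncomputable def adjointCompact (x : CompactOps H) : CompactOps H :=
  ⟨(x : H →L[ℂ] H).adjoint, isCompactOperator_adjoint x.2⟩

@[simp] theorem adjointCompact_rankOneCompact (u v : H) :
    adjointCompact (rankOneCompact u v) = rankOneCompact v u :=
  Subtype.ext (InnerProductSpace.adjoint_rankOne u v)

namespace IsCompletelyPositive

variable {Φ : CompactOps H →ₗ[ℂ] (H →L[ℂ] H)}

theorem isPositive_apply_adjMul (hΦ : IsCompletelyPositive Φ) (y : CompactOps H) :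
    (Φ (adjMul y y)).IsPositive := by
  rw [ContinuousLinearMap.isPositive_iff_complex]
  intro ξ
  have h := hΦ 1 (fun _ => y) (fun _ => ξ)
  simp only [Finset.univ_unique, Finset.sum_singleton] at h
  obtain ⟨hre, him⟩ := Complex.le_def.1 h
  rw [← inner_conj_symm]
  refine ⟨Complex.ext (by simp) ?_, by rw [RCLike.conj_re]; exact hre⟩
  rw [Complex.conj_im, ← him]
  simp

/-- A completely positive map on the compact operators is bounded and preserves adjoints. -/
theorem exists_bound_and_map_adjoint (hΦ : IsCompletelyPositive Φ) :
    (∃ C : ℝ, 0 ≤ C ∧ ∀ x : CompactOps H, ‖Φ x‖ ≤ C * ‖(x : H →L[ℂ] H)‖) ∧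
      ∀ x : CompactOps H, Φ (adjointCompact x) = (Φ x).adjoint := by
  have : IsClosed (compactAlgebra H : Set (H →L[ℂ] H)) := isClosed_compactAlgebra
  let Φ₀ : compactAlgebra H →ₗ[ℂ] (H →L[ℂ] H) :=
    { toFun := fun x => Φ ⟨x.1, x.2⟩
      map_add' := fun x y => Φ.map_add ⟨x.1, x.2⟩ ⟨y.1, y.2⟩
      map_smul' := fun c x => Φ.map_smul c ⟨x.1, x.2⟩ }
  obtain ⟨⟨C, hC0, hC⟩, hstar⟩ := exists_bound_and_map_star_of_nonneg Φ₀ fun y => by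
    rw [ContinuousLinearMap.nonneg_iff_isPositive]
    exact hΦ.isPositive_apply_adjMul ⟨y.1, y.2⟩
  exact ⟨⟨C, hC0, fun x => hC ⟨x.1, x.2⟩⟩, fun x => hstar ⟨x.1, x.2⟩⟩

end IsCompletelyPositive

end CompactOperators
-- The positive kernel of Φ and its multiplicity space
section Kernel

variable {H : Type u} [NormedAddCommGroup H] [InnerProductSpace ℂ H] [CompleteSpace H]
variable {Φ : CompactOps H →ₗ[ℂ] (H →L[ℂ] H)}

open scoped ComplexOrder in
theorem IsCompletelyPositive.sum_finset_nonneg (hΦ : IsCompletelyPositive Φ) {ι : Type*}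
    (s : Finset ι) (a : ι → CompactOps H) (ξ : ι → H) :
    0 ≤ ∑ k ∈ s, ∑ l ∈ s, inner ℂ (ξ k) (Φ (adjMul (a k) (a l)) (ξ l)) := by
  have h := hΦ _ (fun i => a (s.equivFin.symm i)) (fun i => ξ (s.equivFin.symm i))
  have h2 : ∀ f : ι → ℂ, ∑ i, f (s.equivFin.symm i) = ∑ i ∈ s, f i := fun f => by
    rw [Equiv.sum_comp s.equivFin.symm (fun i : s => f i), Finset.sum_coe_sort]
  rw [h2 fun k => ∑ l, inner ℂ (ξ k) (Φ (adjMul (a k) (a (s.equivFin.symm l)))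
    (ξ (s.equivFin.symm l)))] at h
  refine h.trans_eq (Finset.sum_congr rfl fun k _ => ?_)
  exact h2 fun l => inner ℂ (ξ k) (Φ (adjMul (a k) (a l)) (ξ l))

/-- The factor ⟨h, h⟩ = 1 drops out. This brings |u⟩⟨v| into the form a*b in which complete
positivity is stated. -/
theorem adjMul_rankOneCompact {h : H} (hh : ‖h‖ = 1) (u v : H) :
    adjMul (rankOneCompact h u) (rankOneCompact h v) = rankOneCompact u v := by
  apply Subtype.ext
  ext z
  simp [adjMul, hh]

/-- The positive semidefinite kernel `(x, y) ↦ Φ(|x⟩⟨y|)` attached to `Φ`. -/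
noncomputable def rankOneKernel (Φ : CompactOps H →ₗ[ℂ] (H →L[ℂ] H)) : Matrix H H (H →L[ℂ] H) :=
  .of fun x y => Φ (rankOneCompact x y)

theorem IsCompletelyPositive.posSemidef_rankOneKernel [Nontrivial H]
    (hΦ : IsCompletelyPositive Φ) : (rankOneKernel Φ).PosSemidef := by
  obtain ⟨h, hh⟩ := exists_norm_eq H zero_le_one
  have htfae := (RKHS.posSemidef_tfae (K := rankOneKernel Φ)).out 0 2
  refine htfae.mpr ⟨?_, fun w => ?_⟩
  · ext1 x y
    simp only [rankOneKernel, Matrix.conjTranspose_apply, Matrix.of_apply]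
    rw [ContinuousLinearMap.star_eq_adjoint, ← hΦ.exists_bound_and_map_adjoint.2,
      adjointCompact_rankOneCompact]
  · have h1 := (Complex.le_def.1 (hΦ.sum_finset_nonneg w.support (rankOneCompact h) w)).1
    simp only [adjMul_rankOneCompact hh] at h1
    simp only [Finsupp.sum]
    rw [Finset.sum_comm, ← RCLike.conj_re]
    simp only [map_sum, inner_conj_symm]
    rw [Complex.re_sum] at h1
    simp only [Complex.re_sum] at h1
    exact h1

/-- The vectors `k v ξ` form a total family in `L` whose Gram matrix is given by `Φ`. -/
structure IsKernelOf {L : Type*} [NormedAddCommGroup L] [InnerProductSpace ℂ L]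
    (k : H → H →L[ℂ] L) (Φ : CompactOps H →ₗ[ℂ] (H →L[ℂ] H)) : Prop where
  inner_eq : ∀ u v η ξ, inner ℂ (k u η) (k v ξ) = inner ℂ η (Φ (rankOneCompact u v) ξ)
  dense : (Submodule.span ℂ {z | ∃ v ξ, k v ξ = z}).topologicalClosure = ⊤

/-- The Hilbert space generated by the kernel `Φ(|u⟩⟨v|)`: it is the multiplicity space of the
minimal Stinespring representation of `Φ`. -/
theorem IsCompletelyPositive.exists_kernel_vectors [Nontrivial H]
    (hΦ : IsCompletelyPositive Φ) :
    ∃ (L : Type u) (_ : NormedAddCommGroup L) (_ : InnerProductSpace ℂ L) (_ : CompleteSpace L)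
      (k : H → H →L[ℂ] L), IsKernelOf k Φ := by
  have : Fact (rankOneKernel Φ).PosSemidef := ⟨hΦ.posSemidef_rankOneKernel⟩
  refine ⟨RKHS.OfKernel (rankOneKernel Φ), inferInstance, inferInstance, inferInstance,
    RKHS.kerFun _, fun u v η ξ => ?_, RKHS.kerFun_dense _⟩
  rw [← RKHS.kernel_inner, RKHS.OfKernel.kernel_ofKernel]
  simp only [rankOneKernel, Matrix.of_apply]
  rw [← adjointCompact_rankOneCompact, hΦ.exists_bound_and_map_adjoint.2,
    ContinuousLinearMap.adjoint_inner_left]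

end Kernel
-- Bounded columns from orthonormal families in the multiplicity space
section Column

variable {H : Type u} [NormedAddCommGroup H] [InnerProductSpace ℂ H]
variable {L : Type*} [NormedAddCommGroup L] [InnerProductSpace ℂ L]

variable {Φ : CompactOps H →ₗ[ℂ] (H →L[ℂ] H)} {k : H → H →L[ℂ] L}

namespace IsKernelOf

theorem eq_zero (hk : IsKernelOf k Φ) {y : L} (h : ∀ u η, inner ℂ y (k u η) = 0) : y = 0 := by
  have h2 : y ∈ (Submodule.span ℂ {z | ∃ v ξ, k v ξ = z})ᗮ := by
    rw [Submodule.mem_orthogonal']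
    intro z hz
    induction hz using Submodule.span_induction with
    | mem z hz => obtain ⟨v, ξ, rfl⟩ := hz; exact h v ξ
    | zero => simp
    | add _ _ _ _ h1 h2 => rw [inner_add_right, h1, h2, add_zero]
    | smul c _ _ h1 => rw [inner_smul_right, h1, mul_zero]
  rw [← Submodule.orthogonal_closure, hk.dense] at h2
  simpa using h2

theorem ext (hk : IsKernelOf k Φ) {y z : L}
    (h : ∀ u η, inner ℂ (k u η) y = inner ℂ (k u η) z) : y = z := by
  rw [← sub_eq_zero]
  refine hk.eq_zero fun u η => ?_
  rw [← inner_conj_symm, inner_sub_right, h, sub_self, map_zero]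

theorem map_add (hk : IsKernelOf k Φ) (v w ξ : H) : k (v + w) ξ = k v ξ + k w ξ := by
  refine hk.ext fun u η => ?_
  have h : rankOneCompact u (v + w) = rankOneCompact u v + rankOneCompact u w := by
    apply Subtype.ext; simp
  rw [inner_add_right, hk.inner_eq, hk.inner_eq, hk.inner_eq, h, _root_.map_add, add_apply,
    inner_add_right]

theorem map_smul (hk : IsKernelOf k Φ) (c : ℂ) (v ξ : H) :
    k (c • v) ξ = (starRingEnd ℂ) c • k v ξ := by
  refine hk.ext fun u η => ?_
  have h : rankOneCompact u (c • v) = (starRingEnd ℂ) c • rankOneCompact u v := by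
    apply Subtype.ext; simp
  rw [inner_smul_right, hk.inner_eq, hk.inner_eq, h, _root_.map_smul, smul_apply,
    inner_smul_right]

theorem norm_sq_le (hk : IsKernelOf k Φ) {C : ℝ}
    (hC : ∀ x : CompactOps H, ‖Φ x‖ ≤ C * ‖(x : H →L[ℂ] H)‖) (v ξ : H) :
    ‖k v ξ‖ ^ 2 ≤ C * ‖v‖ ^ 2 * ‖ξ‖ ^ 2 := by
  calc ‖k v ξ‖ ^ 2 = ‖inner ℂ ξ (Φ (rankOneCompact v v) ξ)‖ := by
        rw [← hk.inner_eq, inner_self_eq_norm_sq_to_K]; simp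
    _ ≤ ‖ξ‖ * (‖Φ (rankOneCompact v v)‖ * ‖ξ‖) :=
        (norm_inner_le_norm _ _).trans (by gcongr; exact ContinuousLinearMap.le_opNorm _ _)
    _ ≤ ‖ξ‖ * ((C * (‖v‖ * ‖v‖)) * ‖ξ‖) := by
        gcongr
        simpa using hC (rankOneCompact v v)
    _ = C * ‖v‖ ^ 2 * ‖ξ‖ ^ 2 := by ring

theorem norm_le (hk : IsKernelOf k Φ) {C : ℝ} (hC0 : 0 ≤ C)
    (hC : ∀ x : CompactOps H, ‖Φ x‖ ≤ C * ‖(x : H →L[ℂ] H)‖) (v ξ : H) :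
    ‖k v ξ‖ ≤ √C * ‖v‖ * ‖ξ‖ := by
  refine abs_le_of_sq_le_sq' ?_ (by positivity) |>.2
  rw [mul_pow, mul_pow, Real.sq_sqrt hC0]
  exact hk.norm_sq_le hC v ξ

/-- The operators attached to an orthonormal family form a bounded column. -/
theorem sum_norm_sq_le (hk : IsKernelOf k Φ) {C : ℝ} (hC0 : 0 ≤ C)
    (hC : ∀ x : CompactOps H, ‖Φ x‖ ≤ C * ‖(x : H →L[ℂ] H)‖) {γ : Type*} {f : γ → L}
    (hf : Orthonormal ℂ f) {a : γ → H →L[ℂ] H}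
    (ha : ∀ i v ξ, inner ℂ v (a i ξ) = inner ℂ (f i) (k v ξ)) (s : Finset γ) (ξ : H) :
    ∑ i ∈ s, ‖a i ξ‖ ^ 2 ≤ C * ‖ξ‖ ^ 2 := by
  classical
  -- Parseval in `M` and then Bessel in `L` bound the sum by ∑ⱼ ‖k eⱼ ξ‖² = ⟨ξ, Φ(P_M)ξ⟩. As ‖P_M‖ ≤
  -- 1, the bound does not depend on `s`.
  let M : Submodule ℂ H := Submodule.span ℂ (s.image fun i => a i ξ)
  let e := stdOrthonormalBasis ℂ M
  have hM : ∀ i ∈ s, ‖a i ξ‖ ^ 2 = ∑ j, ‖inner ℂ (f i) (k (e j) ξ)‖ ^ 2 := by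
    intro i hi
    have hmem : a i ξ ∈ M := Submodule.subset_span (by simpa using ⟨i, hi, rfl⟩)
    have h := e.sum_sq_norm_inner_right (⟨a i ξ, hmem⟩ : M)
    change _ = ‖a i ξ‖ ^ 2 at h
    rw [← h]
    refine Finset.sum_congr rfl fun j _ => ?_
    rw [← ha, Submodule.coe_inner]
  have hproj : ∑ j, rankOneCompact (e j : H) (e j : H)
      = ⟨M.starProjection, isCompactOperator_starProjection M⟩ := by
    apply Subtype.ext
    rw [AddSubmonoidClass.coe_finsetSum]
    exact (starProjection_eq_sum_rankOne M).symm
  calc ∑ i ∈ s, ‖a i ξ‖ ^ 2 = ∑ j, ∑ i ∈ s, ‖inner ℂ (f i) (k (e j) ξ)‖ ^ 2 := by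
        rw [Finset.sum_congr rfl hM, Finset.sum_comm]
    _ ≤ ∑ j, ‖k (e j) ξ‖ ^ 2 :=
        Finset.sum_le_sum fun j _ => hf.sum_inner_products_le _
    _ = RCLike.re (inner ℂ ξ (Φ (∑ j, rankOneCompact (e j : H) (e j : H)) ξ)) := by
        rw [map_sum, sum_apply, inner_sum, map_sum]
        refine Finset.sum_congr rfl fun j _ => ?_
        rw [← hk.inner_eq, inner_self_eq_norm_sq]
    _ ≤ ‖ξ‖ * (‖Φ (∑ j, rankOneCompact (e j : H) (e j : H))‖ * ‖ξ‖) := by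
        refine (RCLike.re_le_norm _).trans ((norm_inner_le_norm _ _).trans ?_)
        gcongr
        exact ContinuousLinearMap.le_opNorm _ _
    _ ≤ ‖ξ‖ * ((C * 1) * ‖ξ‖) := by
        gcongr
        refine (hC _).trans ?_
        gcongr
        rw [hproj]
        exact M.starProjection_norm_le
    _ = C * ‖ξ‖ ^ 2 := by ring

variable [CompleteSpace H]

/-- For `f : L`, the sesquilinear form `⟨f, k v ξ⟩` is represented by a bounded operator. -/
theorem exists_operator [CompleteSpace L] (hk : IsKernelOf k Φ) (hΦ : IsCompletelyPositive Φ) (f : L) :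
    ∃ a : H →L[ℂ] H, ∀ v ξ, inner ℂ v (a ξ) = inner ℂ f (k v ξ) := by
  obtain ⟨C, hC0, hC⟩ := hΦ.exists_bound_and_map_adjoint.1
  -- The map v ↦ (k v)* f is linear because `k` is conjugate linear in `v`; its adjoint is the
  -- required operator.
  let T : H →L[ℂ] H := LinearMap.mkContinuous
    { toFun := fun v => (k v).adjoint f
      map_add' := fun v w => by
        refine ext_inner_right ℂ fun ξ => ?_
        simp only [inner_add_left, ContinuousLinearMap.adjoint_inner_left, hk.map_add,
          inner_add_right]
      map_smul' := fun c v => by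
        refine ext_inner_right ℂ fun ξ => ?_
        simp only [inner_smul_left, ContinuousLinearMap.adjoint_inner_left, hk.map_smul,
          inner_smul_right, RingHom.id_apply] }
    (√C * ‖f‖) fun v => by
      calc ‖(k v).adjoint f‖ ≤ ‖(k v).adjoint‖ * ‖f‖ := ContinuousLinearMap.le_opNorm _ _
        _ ≤ (√C * ‖v‖) * ‖f‖ := by
            rw [LinearIsometryEquiv.norm_map]
            gcongr
            exact (k v).opNorm_le_bound (by positivity) (hk.norm_le hC0 hC v)
        _ = √C * ‖f‖ * ‖v‖ := by ring
  refine ⟨T.adjoint, fun v ξ => ?_⟩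
  rw [ContinuousLinearMap.adjoint_inner_right]
  exact (k v).adjoint_inner_left ξ f

/-- Every orthonormal family in `L` yields a bounded column operator. -/
theorem exists_column [CompleteSpace L] (hk : IsKernelOf k Φ) (hΦ : IsCompletelyPositive Φ) {γ : Type*}
    {f : γ → L} (hf : Orthonormal ℂ f) :
    ∃ W : H →L[ℂ] Copies γ H, ∀ i v ξ, inner ℂ v (W ξ i) = inner ℂ (f i) (k v ξ) := by
  obtain ⟨C, hC0, hC⟩ := hΦ.exists_bound_and_map_adjoint.1
  choose a ha using fun i => hk.exists_operator hΦ (f i)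
  have hsum : ∀ (ξ : H) (s : Finset γ),
      ∑ i ∈ s, ‖a i ξ‖ ^ (2 : ENNReal).toReal ≤ C * ‖ξ‖ ^ 2 := by
    intro ξ s
    simpa using hk.sum_norm_sq_le hC0 hC hf ha s ξ
  refine ⟨LinearMap.mkContinuous
    { toFun := fun ξ => ⟨fun i => a i ξ, memℓp_gen' (hsum ξ)⟩
      map_add' := fun ξ η => by ext i; exact _root_.map_add (a i) ξ η
      map_smul' := fun c ξ => by ext i; simp }
    (√C) fun ξ => ?_, fun i v ξ => ha i v ξ⟩
  refine lp.norm_le_of_forall_sum_le (by norm_num) (by positivity) fun s => ?_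
  refine (hsum ξ s).trans_eq ?_
  simp [mul_pow, Real.sq_sqrt hC0]

end IsKernelOf

end Column
-- Isometries from Gram matrices; countability of orthonormal families
/-- Two families with the same Gram matrix, the first one total, are related by an isometry. -/
theorem exists_linearIsometry_of_gram {X E F : Type*} [NormedAddCommGroup E]
    [InnerProductSpace ℂ E] [NormedAddCommGroup F] [InnerProductSpace ℂ F] [CompleteSpace F]
    (x : X → E) (y : X → F) (hgram : ∀ i j, inner ℂ (x i) (x j) = inner ℂ (y i) (y j))
    (hx : (Submodule.span ℂ (Set.range x)).topologicalClosure = ⊤) :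
    ∃ J : E →ₗᵢ[ℂ] F, ∀ i, J (x i) = y i := by
  let e := Finsupp.linearCombination ℂ x
  let f := Finsupp.linearCombination ℂ y
  have hnorm : ∀ c, ‖f c‖ = ‖e c‖ := by
    intro c
    have h : inner ℂ (f c) (f c) = inner ℂ (e c) (e c) := by
      simp only [e, f, Finsupp.linearCombination_apply, Finsupp.sum_inner, Finsupp.inner_sum,
        inner_smul_left, inner_smul_right, hgram]
    rw [inner_self_eq_norm_sq_to_K, inner_self_eq_norm_sq_to_K] at h
    have h2 : ‖f c‖ ^ 2 = ‖e c‖ ^ 2 := by exact_mod_cast h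
    exact (sq_eq_sq₀ (norm_nonneg _) (norm_nonneg _)).1 h2
  have hdense : DenseRange e := by
    have h : (Set.range e : Set E) = Submodule.span ℂ (Set.range x) := by
      rw [← Finsupp.range_linearCombination]; rfl
    rw [DenseRange, h]
    exact (Submodule.dense_iff_topologicalClosure_eq_top).2 hx
  have hbd : ∃ C, ∀ c, ‖f c‖ ≤ C * ‖e c‖ := ⟨1, fun c => by rw [hnorm, one_mul]⟩
  have hJ : ∀ c, f.extendOfNorm e (e c) = f c := LinearMap.extendOfNorm_eq hdense hbd
  refine ⟨⟨(f.extendOfNorm e).toLinearMap, fun z => ?_⟩, fun i => ?_⟩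
  · refine hdense.induction_on (p := fun z => ‖f.extendOfNorm e z‖ = ‖z‖) z ?_ fun c => ?_
    · exact isClosed_eq (by fun_prop) continuous_norm
    · rw [hJ, hnorm]
  · have h := hJ (Finsupp.single i 1)
    simpa [e, f] using h

theorem countable_of_orthonormal {ι E : Type*} [NormedAddCommGroup E] [InnerProductSpace ℂ E]
    [TopologicalSpace.SeparableSpace E] {f : ι → E} (hf : Orthonormal ℂ f) : Countable ι := by
  -- Distinct members are at distance √2 ≥ 1, so balls of radius 1/2 are disjoint.
  have hdisj : Set.univ.PairwiseDisjoint fun i => Metric.ball (f i) (1 / 2) := by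
    intro i _ j _ hij
    refine Metric.ball_disjoint_ball ?_
    have h := norm_sub_sq (𝕜 := ℂ) (f i) (f j)
    rw [hf.1, hf.1, hf.2 hij, map_zero] at h
    rw [dist_eq_norm]
    nlinarith [norm_nonneg (f i - f j)]
  exact Set.countable_univ_iff.1 (hdisj.countable_of_isOpen (fun i _ => Metric.isOpen_ball)
    fun i _ => ⟨f i, Metric.mem_ball_self (by norm_num)⟩)

/-! ### Reduction to rank-one operators -/

section CompactExtensionality

variable {H : Type u} [NormedAddCommGroup H] [InnerProductSpace ℂ H] [CompleteSpace H]

/-- A bounded linear map on the compact operators that kills the rank-one operators is zero. -/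
theorem eq_zero_of_rankOneCompact {E : Type*} [NormedAddCommGroup E] [NormedSpace ℂ E]
    (f : CompactOps H →ₗ[ℂ] E) {C : ℝ} (hC0 : 0 ≤ C)
    (hC : ∀ x : CompactOps H, ‖f x‖ ≤ C * ‖(x : H →L[ℂ] H)‖)
    (hf : ∀ u v, f (rankOneCompact u v) = 0) (x : CompactOps H) : f x = 0 := by
  have hle : ∀ ε : ℝ, 0 < ε → ‖f x‖ ≤ C * ε := by
    intro ε hε
    obtain ⟨M, hM, hle⟩ := exists_norm_sub_starProjection_comp_le x.2 hε
    let e := stdOrthonormalBasis ℂ M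
    let y : CompactOps H :=
      ∑ j, rankOneCompact (e j : H) ((x : H →L[ℂ] H).adjoint (e j))
    have hy : (y : H →L[ℂ] H) = M.starProjection ∘L (x : H →L[ℂ] H) := by
      rw [AddSubmonoidClass.coe_finsetSum, starProjection_eq_sum_rankOne,
        ContinuousLinearMap.finsetSum_comp]
      exact Finset.sum_congr rfl fun j _ => (InnerProductSpace.rankOne_comp _ _ _).symm
    have hfy : f y = 0 := by
      rw [map_sum]
      exact Finset.sum_eq_zero fun j _ => hf _ _
    calc ‖f x‖ = ‖f (x - y)‖ := by rw [map_sub, hfy, sub_zero]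
      _ ≤ C * ‖(x : H →L[ℂ] H) - (y : H →L[ℂ] H)‖ := hC _
      _ ≤ C * ε := by rw [hy]; gcongr
  rw [← norm_le_zero_iff]
  refine le_of_forall_pos_le_add fun δ hδ => ?_
  -- The denominator C + 1 also covers the case C = 0.
  refine (hle (δ / (C + 1)) (by positivity)).trans ?_
  rw [zero_add, ← mul_div_assoc, div_le_iff₀ (by positivity)]
  nlinarith

end CompactExtensionality

/-! ### Scalar coordinate families in ℓ²(α) -/

section Coordinates

variable {H : Type u} [NormedAddCommGroup H] [InnerProductSpace ℂ H] {α : Type v}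

theorem memℓp_inner (v : H) (f : Copies α H) : Memℓp (fun i => (inner ℂ v (f i) : ℂ)) 2 := by
  have h : Memℓp ((‖v‖ : ℝ) • fun i => ‖f i‖) 2 := (lp.memℓp (lp.toNorm f)).const_smul ‖v‖
  exact h.mono fun i => by simpa using norm_inner_le_norm v (f i)

/-- The square summable family `(⟨v, fᵢ⟩)ᵢ`. -/
noncomputable def coordInner (v : H) (f : Copies α H) : lp (fun _ : α => ℂ) 2 :=
  ⟨fun i => inner ℂ v (f i), memℓp_inner v f⟩

@[simp] theorem coordInner_apply (v : H) (f : Copies α H) (i : α) :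
    coordInner v f i = inner ℂ v (f i) := rfl

/-- Both sides sum ⟨gᵢ, u⟩⟨v, fᵢ⟩ over i. This passes from ampliations on H^α to inner products in
ℓ²(α). -/
theorem inner_coordInner (u v : H) (g f : Copies α H) :
    inner ℂ (coordInner u g) (coordInner v f) =
      inner ℂ g (ampliation α (InnerProductSpace.rankOne ℂ u v) f) := by
  rw [lp.inner_eq_tsum, lp.inner_eq_tsum]
  refine tsum_congr fun i => ?_
  simp only [coordInner_apply, ampliation_apply, InnerProductSpace.rankOne_apply,
    inner_smul_right, RCLike.inner_apply, inner_conj_symm]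

theorem norm_ampliation_le (x : H →L[ℂ] H) : ‖ampliation α x‖ ≤ ‖x‖ :=
  LinearMap.mkContinuous_norm_le _ (norm_nonneg _) _

/-- Minimality in terms of the families `(⟨v, (V ξ)ᵢ⟩)ᵢ`. -/
theorem coordInner_total [CompleteSpace H] [Nontrivial H] {V : H →L[ℂ] Copies α H}
    (hV : (Submodule.span ℂ {η : Copies α H | ∃ (x : CompactOps H) (ξ : H),
      η = ampliation α (x : H →L[ℂ] H) (V ξ)}).topologicalClosure = ⊤) :
    (Submodule.span ℂ (Set.range fun p : H × H =>
      coordInner p.1 (V p.2))).topologicalClosure = ⊤ := by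
  obtain ⟨h, hh⟩ := exists_norm_eq H zero_le_one
  rw [Submodule.topologicalClosure_eq_top_iff] at hV ⊢
  rw [Submodule.eq_bot_iff] at hV ⊢
  intro c hc
  rw [Submodule.mem_orthogonal'] at hc
  have hmem : Memℓp (fun i => c i • h) 2 :=
    (lp.memℓp (lp.toNorm c)).mono fun i => by simp [norm_smul, hh]
  -- With `g` = c ⊗ h one has ⟨g, (x ⊗ 1)Vξ⟩ = ⟨c, (⟨x*h, (Vξ)ᵢ⟩)ᵢ⟩ = 0, so minimality forces g = 0
  -- and hence c = 0.
  let g : Copies α H := ⟨fun i => c i • h, hmem⟩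
  have hg : g = 0 := by
    refine hV g ((Submodule.mem_orthogonal' _ _).2 fun z hz => ?_)
    induction hz using Submodule.span_induction with
    | mem z hz =>
      obtain ⟨x, ξ, rfl⟩ := hz
      rw [← hc _ (Submodule.subset_span ⟨((x : H →L[ℂ] H).adjoint h, ξ), rfl⟩),
        lp.inner_eq_tsum, lp.inner_eq_tsum]
      refine tsum_congr fun i => ?_
      change inner ℂ (c i • h) ((x : H →L[ℂ] H) (V ξ i)) =
        inner ℂ (c i) (inner ℂ ((x : H →L[ℂ] H).adjoint h) (V ξ i))
      rw [ContinuousLinearMap.adjoint_inner_left, inner_smul_left, RCLike.inner_apply, mul_comm]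
    | zero => simp
    | add _ _ _ _ h1 h2 => rw [inner_add_right, h1, h2, add_zero]
    | smul c _ _ h1 => rw [inner_smul_right, h1, mul_zero]
  ext i
  have hi : c i • h = 0 := congrArg (fun f : Copies α H => f i) hg
  have hne : h ≠ 0 := by
    rintro rfl
    simp at hh
  simpa using (smul_eq_zero.1 hi).resolve_right hne

end Coordinates
-- Columns of orthonormal bases implement minimal representations
section ColumnOfBasis

variable {H : Type u} [NormedAddCommGroup H] [InnerProductSpace ℂ H]
variable {L : Type*} [NormedAddCommGroup L] [InnerProductSpace ℂ L]
variable {Φ : CompactOps H →ₗ[ℂ] (H →L[ℂ] H)} {k : H → H →L[ℂ] L}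

namespace IsKernelOf

variable {γ : Type v} {b : HilbertBasis γ ℂ L} {W : H →L[ℂ] Copies γ H}

theorem coordInner_eq_repr (hW : ∀ i v ξ, inner ℂ v (W ξ i) = inner ℂ (b i) (k v ξ)) (v ξ : H) :
    coordInner v (W ξ) = b.repr (k v ξ) := by
  ext i
  rw [coordInner_apply, hW, b.repr_apply_apply]

variable [CompleteSpace H]

/-- The multiplicity space is separable. -/
theorem separableSpace [TopologicalSpace.SeparableSpace H] (hk : IsKernelOf k Φ)
    (hΦ : IsCompletelyPositive Φ) : TopologicalSpace.SeparableSpace L := by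
  obtain ⟨C, hC0, hC⟩ := hΦ.exists_bound_and_map_adjoint.1
  have hcont : Continuous k := by
    refine LipschitzWith.continuous (K := ⟨√C, Real.sqrt_nonneg C⟩)
      (LipschitzWith.of_dist_le_mul fun v w => ?_)
    have h : k v - k w = k (v - w) := by
      ext ξ
      rw [sub_apply, sub_eq_iff_eq_add, ← hk.map_add, sub_add_cancel]
    rw [dist_eq_norm, dist_eq_norm, h]
    exact (k (v - w)).opNorm_le_bound
      (mul_nonneg (Real.sqrt_nonneg C) (norm_nonneg _)) (hk.norm_le hC0 hC _)
  have hcont2 : Continuous fun p : H × H => k p.1 p.2 :=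
    (hcont.comp continuous_fst).clm_apply continuous_snd
  have hset : {z | ∃ v ξ, k v ξ = z} = Set.range fun p : H × H => k p.1 p.2 := by
    ext z; simp
  have hsep := (TopologicalSpace.isSeparable_range hcont2).span (R := ℂ)
  rw [← hset] at hsep
  have h := hsep.closure
  rw [← Submodule.topologicalClosure_coe, hk.dense] at h
  exact TopologicalSpace.isSeparable_univ_iff.1 h

/-- Both sides are bounded in x, so rank-one x suffice; there the identity is Parseval for `b`. -/
theorem implements (hk : IsKernelOf k Φ) (hΦ : IsCompletelyPositive Φ)
    (hW : ∀ i v ξ, inner ℂ v (W ξ i) = inner ℂ (b i) (k v ξ)) : Implements W Φ := by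
  obtain ⟨C, hC0, hC⟩ := hΦ.exists_bound_and_map_adjoint.1
  let Θ : CompactOps H →ₗ[ℂ] (H →L[ℂ] H) :=
    { toFun := fun x => W.adjoint ∘L ampliation γ (x : H →L[ℂ] H) ∘L W
      map_add' := fun x y => by
        have h : ampliation γ ((x + y : CompactOps H) : H →L[ℂ] H)
            = ampliation γ (x : H →L[ℂ] H) + ampliation γ (y : H →L[ℂ] H) := by
          ext f i; rfl
        rw [h, ContinuousLinearMap.add_comp, ContinuousLinearMap.comp_add]
      map_smul' := fun c x => by
        have h : ampliation γ ((c • x : CompactOps H) : H →L[ℂ] H)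
            = c • ampliation γ (x : H →L[ℂ] H) := by
          ext f i; rfl
        rw [h, ContinuousLinearMap.smul_comp, ContinuousLinearMap.comp_smul, RingHom.id_apply] }
  intro x
  have h := eq_zero_of_rankOneCompact (Φ - Θ) (C := C + ‖W‖ * ‖W‖) (by positivity) ?_ ?_ x
  · exact sub_eq_zero.1 h
  · intro x
    calc ‖(Φ - Θ) x‖ ≤ ‖Φ x‖ + ‖Θ x‖ := norm_sub_le _ _
      _ ≤ C * ‖(x : H →L[ℂ] H)‖ + ‖W‖ * (‖(x : H →L[ℂ] H)‖ * ‖W‖) := by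
          gcongr
          · exact hC x
          · refine (ContinuousLinearMap.opNorm_comp_le _ _).trans ?_
            rw [LinearIsometryEquiv.norm_map]
            gcongr
            refine (ContinuousLinearMap.opNorm_comp_le _ _).trans ?_
            gcongr
            exact norm_ampliation_le _
      _ = (C + ‖W‖ * ‖W‖) * ‖(x : H →L[ℂ] H)‖ := by ring
  · intro u v
    rw [LinearMap.sub_apply, sub_eq_zero]
    ext ξ
    refine ext_inner_left ℂ fun η => ?_
    change _ = inner ℂ η (W.adjoint (ampliation γ (InnerProductSpace.rankOne ℂ u v) (W ξ)))
    rw [ContinuousLinearMap.adjoint_inner_right, ← inner_coordInner, coordInner_eq_repr hW,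
      coordInner_eq_repr hW, LinearIsometryEquiv.inner_map_map, hk.inner_eq]

/-- If g is orthogonal to every (|u⟩⟨v| ⊗ 1)Wξ, then for each u the vector of `L` with coordinates
⟨u, gᵢ⟩ is orthogonal to the total family `k v ξ`, hence zero. -/
theorem implementsMinimal (hk : IsKernelOf k Φ) (hΦ : IsCompletelyPositive Φ)
    (hW : ∀ i v ξ, inner ℂ v (W ξ i) = inner ℂ (b i) (k v ξ)) : ImplementsMinimal W Φ := by
  refine ⟨hk.implements hΦ hW, ?_⟩
  rw [Submodule.topologicalClosure_eq_top_iff, Submodule.eq_bot_iff]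
  intro g hg
  rw [Submodule.mem_orthogonal'] at hg
  have h0 : ∀ u, coordInner u g = 0 := by
    intro u
    have h : b.repr.symm (coordInner u g) = 0 := by
      refine hk.eq_zero fun v ξ => ?_
      rw [← LinearIsometryEquiv.inner_map_map b.repr, LinearIsometryEquiv.apply_symm_apply,
        ← coordInner_eq_repr hW, inner_coordInner]
      exact hg _ (Submodule.subset_span ⟨rankOneCompact u v, ξ, rfl⟩)
    simpa using h
  ext i
  refine ext_inner_left ℂ fun u => ?_
  rw [← coordInner_apply, h0]
  simp

/-- If `Φ` is a bimodule map over `D`, the entries of `W` commute with `D`. -/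
theorem hasEntriesIn_centralizer {D : StarSubalgebra ℂ (H →L[ℂ] H)} (hk : IsKernelOf k Φ)
    (hmod : IsBimoduleMap (D : Set (H →L[ℂ] H)) Φ)
    (hW : ∀ i v ξ, inner ℂ v (W ξ i) = inner ℂ (b i) (k v ξ)) :
    HasEntriesIn W (Set.centralizer (D : Set (H →L[ℂ] H))) := by
  intro i
  rw [Set.mem_centralizer_iff]
  intro d hd
  ext ξ
  refine ext_inner_left ℂ fun v => ?_
  change inner ℂ v (d (W ξ i)) = inner ℂ v (W (d ξ) i)
  rw [← ContinuousLinearMap.adjoint_inner_left, hW, hW]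
  congr 1
  refine hk.ext fun u η => ?_
  -- Since |u⟩⟨d*v| = |u⟩⟨v|d, the bimodule property with left factor 1 gives k (d*v) ξ = k v (dξ).
  have h : rankOneCompact u (d.adjoint v) = sandwich 1 (rankOneCompact u v) d := by
    apply Subtype.ext
    ext z
    simp [sandwich, ContinuousLinearMap.adjoint_inner_left]
  rw [hk.inner_eq, hk.inner_eq, h, hmod 1 (one_mem D) d hd]
  rfl

end IsKernelOf

end ColumnOfBasis

/-! ### Lifting from the corner -/

section Lifting

variable {H₂ : Type u} [NormedAddCommGroup H₂] [InnerProductSpace ℂ H₂]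
variable {H₁ : Submodule ℂ H₂} [CompleteSpace H₁]
variable {L : Type*} [NormedAddCommGroup L] [InnerProductSpace ℂ L]
variable {Φ : CompactOps H₂ →ₗ[ℂ] (H₂ →L[ℂ] H₂)} {k : H₂ → H₂ →L[ℂ] L}
variable {β γ : Type v} {V : H₁ →L[ℂ] Copies β H₁}

theorem extendByZero_rankOneCompact (u v : H₁) :
    extendByZero H₁ (rankOneCompact u v) = rankOneCompact (u : H₂) (v : H₂) := by
  apply Subtype.ext
  ext z
  simp [extendByZero, sandwich]

/-- A minimal representation of the compression of `Φ` embeds its multiplicity space in that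
of `Φ`. -/
theorem IsKernelOf.exists_linearIsometry [CompleteSpace L] [Nontrivial H₁] (hk : IsKernelOf k Φ)
    (hmin : ImplementsMinimal V (compress H₁ Φ)) :
    ∃ J : lp (fun _ : β => ℂ) 2 →ₗᵢ[ℂ] L,
      ∀ v ξ : H₁, J (coordInner v (V ξ)) = k (v : H₂) (ξ : H₂) := by
  suffices hgram : ∀ p q : H₁ × H₁, inner ℂ (coordInner p.1 (V p.2)) (coordInner q.1 (V q.2)) =
      inner ℂ (k (p.1 : H₂) (p.2 : H₂)) (k (q.1 : H₂) (q.2 : H₂)) by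
    obtain ⟨J, hJ⟩ := exists_linearIsometry_of_gram
      (fun p : H₁ × H₁ => coordInner p.1 (V p.2)) (fun p => k (p.1 : H₂) (p.2 : H₂))
      hgram (coordInner_total hmin.2)
    exact ⟨J, fun v ξ => hJ (v, ξ)⟩
  intro p q
  rw [inner_coordInner, ← ContinuousLinearMap.adjoint_inner_right, hk.inner_eq,
    ← extendByZero_rankOneCompact]
  change inner ℂ p.2 ((V.adjoint ∘L ampliation β
    (rankOneCompact p.1 q.1 : H₁ →L[ℂ] H₁) ∘L V) q.2) = _
  rw [← hmin.1 (rankOneCompact p.1 q.1)]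
  change inner ℂ p.2 (H₁.orthogonalProjectionOnto _) = _
  rw [Submodule.inner_orthogonalProjectionOnto_eq_of_mem_left]
  rfl

variable [CompleteSpace H₂]

/-- If the basis of the multiplicity space extends the image of the standard basis of `ℓ²(β)`, then
the column of `Φ` restricts to `V`. -/
theorem restrictsTo_of_basis {D : StarSubalgebra ℂ (H₂ →L[ℂ] H₂)}
    (hp : H₁.starProjection ∈ D) {J : lp (fun _ : β => ℂ) 2 →ₗᵢ[ℂ] L}
    (hJ : ∀ v ξ : H₁, J (coordInner v (V ξ)) = k (v : H₂) (ξ : H₂)) [DecidableEq β]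
    {b : γ → L} (hb : Orthonormal ℂ b) {e : β ↪ γ} (he : ∀ i, b (e i) = J (lp.single 2 i 1))
    {W : H₂ →L[ℂ] Copies γ H₂} (hW : ∀ i v ξ, inner ℂ v (W ξ i) = inner ℂ (b i) (k v ξ))
    (hWD : HasEntriesIn W (Set.centralizer (D : Set (H₂ →L[ℂ] H₂)))) : RestrictsTo e W V := by
  -- The entries of `W` commute with the projection onto H₁, so they leave H₁ invariant; testing
  -- against vectors of H₁ then suffices.
  have hmem : ∀ (ξ : H₁) j, W (ξ : H₂) j ∈ H₁ := by
    intro ξ j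
    have h : H₁.starProjection (W (ξ : H₂) j) = W (H₁.starProjection (ξ : H₂)) j :=
      congrArg (fun T : H₂ →L[ℂ] H₂ => T (ξ : H₂))
        (Set.mem_centralizer_iff.1 (hWD j) H₁.starProjection hp)
    rw [Submodule.starProjection_eq_self_iff.2 ξ.2] at h
    exact Submodule.starProjection_eq_self_iff.1 h
  have hext : ∀ (ξ : H₁) (j : γ) (y : H₁),
      (∀ v : H₁, inner ℂ (b j) (k (v : H₂) (ξ : H₂)) = inner ℂ v y) → W (ξ : H₂) j = y := by
    intro ξ j y h
    have h2 : (⟨W (ξ : H₂) j, hmem ξ j⟩ : H₁) = y := by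
      refine ext_inner_left ℂ fun v => ?_
      rw [← h v, ← hW, Submodule.coe_inner]
    exact congrArg Subtype.val h2
  refine fun ξ => ⟨fun i => hext ξ (e i) (V ξ i) fun v => ?_, fun j hj => ?_⟩
  · rw [he, ← hJ, LinearIsometry.inner_map_map, lp.inner_single_left]
    simp
  · refine hext ξ j 0 fun v => ?_
    -- Expand in the standard basis of ℓ²(β): `b j` is orthogonal to the image of each basis vector.
    have hs := (lp.hasSum_single (p := 2) (by norm_num) (coordInner v (V ξ))).mapL
      (innerSL ℂ (b j) ∘L J.toContinuousLinearMap)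
    rw [← hJ, inner_zero_right]
    refine hs.unique ?_
    convert hasSum_zero using 2 with i
    have hi : lp.single (E := fun _ : β => ℂ) 2 i (coordInner v (V ξ) i)
        = (coordInner v (V ξ) i) • lp.single 2 i 1 := by
      rw [← lp.single_smul]; simp
    rw [hi, map_smul]
    change _ • inner ℂ (b j) (J _) = 0
    rw [← he, hb.2 fun h => hj ⟨i, h.symm⟩, smul_zero]

end Lifting
end StinespringLift

open StinespringLift in
theorem theorem3p3 {H₂ : Type u} [NormedAddCommGroup H₂] [InnerProductSpace ℂ H₂]
    [CompleteSpace H₂] [TopologicalSpace.SeparableSpace H₂]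
    (D₂ : StarSubalgebra ℂ (H₂ →L[ℂ] H₂)) (hD₂ : IsClosed (D₂ : Set (H₂ →L[ℂ] H₂)))
    (H₁ : Submodule ℂ H₂) [CompleteSpace H₁] (hH₁ : H₁ ≠ ⊥)
    (hp : H₁.starProjection ∈ D₂)
    (Φ : CompactOps H₂ →ₗ[ℂ] (H₂ →L[ℂ] H₂)) (hΦ : IsCompletelyPositive Φ)
    (hmod : IsBimoduleMap (D₂ : Set (H₂ →L[ℂ] H₂)) Φ)
    {β : Type v} [Countable β] (V : H₁ →L[ℂ] Copies β H₁)
    (hV : HasEntriesIn V (Set.centralizer (corner H₁ (D₂ : Set (H₂ →L[ℂ] H₂)))))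
    (hmin : ImplementsMinimal V (compress H₁ Φ)) :
    ∃ (γ : Type v) (_ : Countable γ) (e : β ↪ γ) (W : H₂ →L[ℂ] Copies γ H₂),
      HasEntriesIn W (Set.centralizer (D₂ : Set (H₂ →L[ℂ] H₂))) ∧
      ImplementsMinimal W Φ ∧ RestrictsTo e W V := by
  classical
  have : Nontrivial H₁ := Submodule.nontrivial_iff_ne_bot.2 hH₁
  have : Nontrivial H₂ := H₁.subtype_injective.nontrivial
  obtain ⟨L, _, _, _, k, hk⟩ := hΦ.exists_kernel_vectors
  have : TopologicalSpace.SeparableSpace L := hk.separableSpace hΦ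
  obtain ⟨J, hJ⟩ := hk.exists_linearIsometry hmin
  have hJs : Orthonormal ℂ fun i : β => J (lp.single (E := fun _ : β => ℂ) 2 i 1) := by
    refine Orthonormal.comp_linearIsometry ?_ J
    rw [orthonormal_iff_ite]
    intro i j
    rw [lp.inner_single_left]
    simp [lp.single_apply, Pi.single_apply]
  obtain ⟨w, b, hsw, hbw⟩ := hJs.toSubtypeRange.exists_hilbertBasis_extension
  have hwc : Countable w := countable_of_orthonormal b.orthonormal
  -- The index set `w` consists of vectors of `L`; being countable, it can be moved to the universe
  -- of β.
  let σ : Shrink.{v} w ≃ w := (equivShrink.{v} w).symm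
  let b' : HilbertBasis (Shrink.{v} w) ℂ L :=
    HilbertBasis.mk (v := b ∘ σ) (b.orthonormal.comp σ σ.injective) (by
      rw [σ.surjective.range_comp, b.dense_span])
  have hb' : ∀ j, b' j = (σ j : L) := fun j => by
    rw [HilbertBasis.coe_mk, Function.comp_apply, hbw]
  let e : β ↪ Shrink.{v} w :=
    ⟨fun i => σ.symm ⟨_, hsw ⟨i, rfl⟩⟩, fun i j h =>
      hJs.linearIndependent.injective (congrArg Subtype.val (σ.symm.injective h))⟩
  have he : ∀ i, b' (e i) = J (lp.single 2 i 1) := fun i => by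
    rw [hb']
    exact congrArg Subtype.val (σ.apply_symm_apply _)
  obtain ⟨W, hW⟩ := hk.exists_column hΦ b'.orthonormal
  have hWD := hk.hasEntriesIn_centralizer hmod hW
  exact ⟨Shrink.{v} w, σ.countable_iff.2 hwc, e, W, hWD, hk.implementsMinimal hΦ hW,
    restrictsTo_of_basis hp hJ b'.orthonormal he hW hWD⟩
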